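/- Let $f:\mathbb{R}^n\to\mathbb{R}$ and $g:\mathbb{R}^n\to\mathbb{R}^m$ be continuously differentiable, with $f$ strictly concave, every component $g_i$ convex, and the gradients $\nabla f,\nabla g_1,\dots,\nabla g_m$ locally Lipschitz. Assume Slater's condition: there is $x\in\mathbb{R}^n$ with $g_i(x)<0$ for all $i$. Let $L(x,\lambda)=f(x)-\lambda^\top g(x)$. A saddle point of $L$ is a point $(x_*,\lambda_*)\in\mathbb{R}^n\times\mathbb{R}^m_{\ge 0}$ with $L(x,\lambda_*)\le L(x_*,\lambda_*)\le L(x_*,\lambda)$ for all $x\in\mathbb{R}^n$ and $\lambda\in\mathbb{R}^m_{\ge 0}$. The primal-dual dynamics on $\mathbb{R}^n\times\mathbb{R}^m_{\ge 0}$ is $$\dot x=\nabla f(x)-\sum_{i=1}^m\lambda_i\nabla g_i(x),\qquad \dot\lambda_i=[g_i(x)]^+_{\lambda_i}\quad(i=1,\dots,m),$$ where $[a]^+_b=a$ if $b>0$ and $[a]^+_b=\max\{0,a\}$ if $b=0$. A (Carathéodory) solution on $[0,T)$, $0<T\le\infty$, is a curve $\gamma$ that is absolutely continuous on every compact subinterval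 of $[0,T)$ and, for almost every $t\in[0,T)$, lies in $\mathbb{R}^n\times\mathbb{R}^m_{\ge 0}$ and satisfies the equations at time $t$. **(Existence, uniqueness, invariance.)** For every $z_0\in\mathbb{R}^n\times\mathbb{R}^m_{\ge 0}$ there is a solution $\gamma$ of the primal-dual dynamics on $[0,\infty)$ with $\gamma(0)=z_0$. Every solution on an interval $[0,T)$, $0<T\le\infty$, that starts at $z_0$ coincides with $\gamma$ on $[0,T)$. Moreover, $\gamma(t)\in\mathbb{R}^n\times\mathbb{R}^m_{\ge 0}$ for all $t\ge 0$, and for every saddle point $(x_*,\lambda_*)$ of $L$, with $V(x,\lambda)=\tfrac12\left(\|x-x_*\|^2+\|\lambda-\lambda_*\|^2\right)$, one has $V(\gamma(t))\le V(z_0)$ for all $t\ge 0$. **(Continuity with respect to the initial condition.)** If $z_k\to z_0$ in $\mathbb{R}^n\times\mathbb{R}^m_{\ge 0}$, then the solutions $\gamma_k$ on $[0,\infty)$ with $\gamma_k(0)=z_k$ converge to the solution $\gamma$ on $[0,\infty)$ with $\gamma(0)=z_0$, uniformly on every compact subset of $[0,\infty)$. -/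

import Mathlib

namespace PrimalDual

/-- The space `ℝⁿ × ℝᵐ` of pairs `(x, λ)`. -/
abbrev State (n m : ℕ) : Type := EuclideanSpace ℝ (Fin n) × EuclideanSpace ℝ (Fin m)

/-- The set `ℝⁿ × ℝᵐ_{≥0}` on which the primal-dual dynamics live. -/
def domain (n m : ℕ) : Set (State n m) := {z | ∀ i, 0 ≤ z.2 i}

/-- The operator `[a]_b^+`, used for `b ≥ 0` only: it is `a` if `b > 0`, and `max {0, a}`
if `b = 0`. -/
noncomputable def posPart (a b : ℝ) : ℝ := if 0 < b then a else max 0 a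

/-- The Lagrangian `L(x, λ) = f(x) - λᵀ g(x)`. -/
noncomputable def lagrangian {n m : ℕ} (f : EuclideanSpace ℝ (Fin n) → ℝ)
    (g : EuclideanSpace ℝ (Fin n) → EuclideanSpace ℝ (Fin m)) (z : State n m) : ℝ :=
  f z.1 - ∑ i, z.2 i * g z.1 i

/-- `zs = (x⋆, λ⋆)` is a saddle point of the Lagrangian over `ℝⁿ × ℝᵐ_{≥0}`. -/
def IsSaddle {n m : ℕ} (f : EuclideanSpace ℝ (Fin n) → ℝ)
    (g : EuclideanSpace ℝ (Fin n) → EuclideanSpace ℝ (Fin m)) (zs : State n m) : Prop :=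
  zs ∈ domain n m ∧
    (∀ x : EuclideanSpace ℝ (Fin n), lagrangian f g (x, zs.2) ≤ lagrangian f g zs) ∧
    (∀ l : EuclideanSpace ℝ (Fin m), (∀ i, 0 ≤ l i) →
      lagrangian f g zs ≤ lagrangian f g (zs.1, l))

/-- Half the squared distance to `zs = (x⋆, λ⋆)`:
`V(x, λ) = (‖x - x⋆‖² + ‖λ - λ⋆‖²) / 2`, with Euclidean norms. -/
noncomputable def V {n m : ℕ} (zs z : State n m) : ℝ :=
  (1 / 2) * (‖z.1 - zs.1‖ ^ 2 + ‖z.2 - zs.2‖ ^ 2)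

/-- The right-hand side of the primal-dual dynamics,
`(∇f(x) - ∑ᵢ λᵢ ∇gᵢ(x), [g(x)]_λ^+)`; it is used on `domain n m` only. -/
noncomputable def field {n m : ℕ} (f : EuclideanSpace ℝ (Fin n) → ℝ)
    (g : EuclideanSpace ℝ (Fin n) → EuclideanSpace ℝ (Fin m)) (z : State n m) : State n m :=
  (gradient f z.1 - ∑ i, z.2 i • gradient (fun y => g y i) z.1,
    WithLp.toLp 2 (fun i => posPart (g z.1 i) (z.2 i)))

/-- Carathéodory solutions on `[0, T)`, `T ≤ ∞`, of `γ' = F(γ)` for a vector field `F` given on a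
set `D`: `γ` is absolutely continuous on every `[0, b]` with `0 ≤ b < T`, and for almost every
`t ∈ [0, T)` one has `γ(t) ∈ D` (so that `F(γ(t))` is meaningful) and `γ'(t) = F(γ(t))`. -/
def IsCaratheodorySolution {E : Type*} [NormedAddCommGroup E] [NormedSpace ℝ E]
    (D : Set E) (F : E → E) (T : EReal) (γ : ℝ → E) : Prop :=
  (∀ b : ℝ, 0 ≤ b → (b : EReal) < T → AbsolutelyContinuousOnInterval γ 0 b) ∧
    ∀ᵐ t : ℝ ∂MeasureTheory.volume, 0 ≤ t → (t : EReal) < T →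
      γ t ∈ D ∧ HasDerivAt γ (F (γ t)) t

end PrimalDual

namespace PrimalDual

open Set Filter Topology MeasureTheory
open scoped NNReal RealInnerProductSpace

/-! The vector field is discontinuous where a multiplier vanishes, but on the domain it is
dissipative: `dot (F z - F w) (z - w) ≤ 0` (`dot_field_sub_nonpos`), by concavity of `f`, convexity
of the `g i` and the sign of the projection terms. Hence the distance measured by `V` between two
solutions never increases (`V_antitone_of_solvesOn`). Uniqueness and continuous dependence follow at
once; so does the bound at a saddle point, which is an equilibrium (`field_eq_zero_of_isSaddle`).

Existence rests on Skorokhod reflection. For a globally Lipschitz `H`, the equation `u' = H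
(reflectPath u)` has a Lipschitz causal right-hand side, so Picard iteration solves it, and
`reflectPath u` then solves the projected equation (`exists_solvesOn_projectedField`). The
unprojected field is only locally Lipschitz: it is replaced outside a ball, and an a priori bound
from dissipativity (`V_le_of_solvesOn`) keeps the solution inside. Solutions on `[0, N + 1]` are
glued by uniqueness. -/

/-- The running supremum `sup_{0 ≤ s ≤ t} w s`, parametrized by the unit interval. -/
noncomputable def runningSup (w : ℝ → ℝ) (t : ℝ) : ℝ :=
  sSup ((fun θ => w (θ * t)) '' Icc 0 1)

/-! ### Running suprema of continuous paths. -/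

section RunningSup

variable {w : ℝ → ℝ}

theorem continuous_runningSup (hw : Continuous w) : Continuous (runningSup w) :=
  isCompact_Icc.continuous_sSup (f := fun t θ => w (θ * t)) (by fun_prop)

theorem le_runningSup (hw : Continuous w) {s t : ℝ} (hs : 0 ≤ s) (hst : s ≤ t) :
    w s ≤ runningSup w t := by
  refine le_csSup (isCompact_Icc.bddAbove_image (by fun_prop)) ?_
  rcases hs.eq_or_lt with rfl | hs
  · exact ⟨0, by simp, by simp⟩
  · have ht : 0 < t := hs.trans_le hst
    exact ⟨s / t, ⟨by positivity, (div_le_one ht).2 hst⟩, by simp [ht.ne']⟩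

theorem runningSup_le {t c : ℝ} (ht : 0 ≤ t) (h : ∀ s, 0 ≤ s → s ≤ t → w s ≤ c) :
    runningSup w t ≤ c := by
  refine csSup_le ((nonempty_Icc.2 zero_le_one).image _) ?_
  rintro _ ⟨θ, hθ, rfl⟩
  exact h _ (mul_nonneg hθ.1 ht) (mul_le_of_le_one_left ht hθ.2)

theorem runningSup_mono (hw : Continuous w) {s t : ℝ} (hs : 0 ≤ s) (hst : s ≤ t) :
    runningSup w s ≤ runningSup w t :=
  runningSup_le hs fun _ h0 h1 => le_runningSup hw h0 (h1.trans hst)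

theorem abs_runningSup_sub_le {w' : ℝ → ℝ} (hw : Continuous w) (hw' : Continuous w') {t c : ℝ}
    (ht : 0 ≤ t) (h : ∀ s, 0 ≤ s → s ≤ t → |w s - w' s| ≤ c) :
    |runningSup w t - runningSup w' t| ≤ c := by
  rw [abs_sub_le_iff]
  constructor
  · have : runningSup w t ≤ runningSup w' t + c := runningSup_le ht fun s h0 h1 => by
      have := (abs_sub_le_iff.1 (h s h0 h1)).1
      linarith [le_runningSup hw' h0 h1]
    linarith
  · have : runningSup w' t ≤ runningSup w t + c := runningSup_le ht fun s h0 h1 => by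
      have := (abs_sub_le_iff.1 (h s h0 h1)).2
      linarith [le_runningSup hw h0 h1]
    linarith

theorem lipschitzOnWith_runningSup (hw : Continuous w) {b : ℝ} {K : ℝ≥0}
    (h : LipschitzOnWith K w (Icc 0 b)) : LipschitzOnWith K (runningSup w) (Icc 0 b) := by
  refine LipschitzOnWith.of_le_add_mul K fun t ht s hs => ?_
  rcases le_total t s with hts | hst
  · exact (runningSup_mono hw ht.1 hts).trans (le_add_of_nonneg_right (by positivity))
  refine runningSup_le ht.1 fun θ h0 h1 => ?_
  rcases le_total θ s with hθ | hθ
  · exact (le_runningSup hw h0 hθ).trans (le_add_of_nonneg_right (by positivity))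
  · have h2 := h.le_add_mul ⟨h0, h1.trans ht.2⟩ hs
    have h3 : dist θ s ≤ dist t s := by
      rw [Real.dist_eq, Real.dist_eq, abs_of_nonneg (by linarith), abs_of_nonneg (by linarith)]
      linarith
    have h4 : (K : ℝ) * dist θ s ≤ K * dist t s := by gcongr
    linarith [le_runningSup hw hs.1 le_rfl]

/-- Near `t` the path stays below a level that the running supremum exceeds, so no new maximum is
reached there. -/
theorem runningSup_eventually_eq (hw : Continuous w) {t : ℝ} (ht : 0 < t)
    (h : w t < runningSup w t) : ∀ᶠ s in 𝓝 t, runningSup w s = runningSup w t := by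
  obtain ⟨c, h1, h2⟩ := exists_between h
  have hev : ∀ᶠ s in 𝓝 t, w s < c ∧ c < runningSup w s ∧ 0 < s :=
    (hw.continuousAt.eventually_lt_const h1).and
      (((continuous_runningSup hw).continuousAt.eventually_const_lt h2).and (lt_mem_nhds ht))
  obtain ⟨ε, hε, hball⟩ := Metric.eventually_nhds_iff_ball.1 hev
  have key : ∀ s ∈ Metric.ball t ε, ∀ s' ∈ Metric.ball t ε, s ≤ s' →
      runningSup w s' = runningSup w s := by
    intro s hs s' hs' hss
    refine le_antisymm (runningSup_le (hball s' hs').2.2.le fun θ h0 hθ => ?_)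
      (runningSup_mono hw (hball s hs).2.2.le hss)
    rcases le_total θ s with hle | hle
    · exact le_runningSup hw h0 hle
    · have : θ ∈ Metric.ball t ε := by
        rw [Real.ball_eq_Ioo] at *
        exact ⟨hs.1.trans_le hle, hθ.trans_lt hs'.2⟩
      exact ((hball θ this).1.trans (hball s hs).2.1).le
  filter_upwards [Metric.ball_mem_nhds t hε] with s hs
  rcases le_total s t with hst | hst
  · exact (key s hs t (Metric.mem_ball_self hε) hst).symm
  · exact key t (Metric.mem_ball_self hε) s hs hst

end RunningSup

/-- The Skorokhod reflection at `0` of a real path. -/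
noncomputable def reflection (y : ℝ → ℝ) (t : ℝ) : ℝ :=
  y t + max 0 (runningSup (fun s => -y s) t)

/-! ### One-dimensional Skorokhod reflection. -/

section Reflection

variable {y : ℝ → ℝ}

theorem continuous_reflection (hy : Continuous y) : Continuous (reflection y) :=
  hy.add (continuous_const.max (continuous_runningSup hy.neg))

theorem reflection_nonneg (hy : Continuous y) {t : ℝ} (ht : 0 ≤ t) : 0 ≤ reflection y t := by
  have h1 := le_runningSup hy.fun_neg ht le_rfl
  have h2 := le_max_right 0 (runningSup (fun s => -y s) t)
  unfold reflection
  linarith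

theorem reflection_zero (h0 : 0 ≤ y 0) : reflection y 0 = y 0 := by
  have : runningSup (fun s => -y s) 0 ≤ 0 := runningSup_le le_rfl fun s h1 h2 => by
    rw [le_antisymm h2 h1]; linarith
  simp [reflection, this]

/-- The factor 2 counts the path once and its regulator (the added running supremum) once. -/
theorem abs_reflection_sub_le {y' : ℝ → ℝ} (hy : Continuous y) (hy' : Continuous y') {t c : ℝ}
    (ht : 0 ≤ t) (h : ∀ s, 0 ≤ s → s ≤ t → |y s - y' s| ≤ c) :
    |reflection y t - reflection y' t| ≤ 2 * c := by
  have h1 := abs_runningSup_sub_le hy.fun_neg hy'.fun_neg ht fun s h0 hs => by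
    simpa only [neg_sub_neg, abs_sub_comm] using h s h0 hs
  have h2 := (abs_max_sub_max_le_abs (runningSup (fun s => -y s) t)
    (runningSup (fun s => -y' s) t) 0).trans h1
  rw [max_comm _ (0 : ℝ), max_comm _ (0 : ℝ)] at h2
  have h3 := h t ht le_rfl
  unfold reflection
  rw [abs_le] at *
  constructor <;> linarith

theorem absolutelyContinuousOnInterval_reflection (hy : ContDiff ℝ 1 y) {b : ℝ} (hb : 0 ≤ b) :
    AbsolutelyContinuousOnInterval (reflection y) 0 b := by
  obtain ⟨K, hK⟩ := (hy.neg.locallyLipschitz.locallyLipschitzOn (s := Icc 0 b)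
    ).exists_lipschitzOnWith_of_compact isCompact_Icc
  have h1 := lipschitzOnWith_runningSup hy.continuous.neg hK
  have h2 : LipschitzOnWith K (fun t => max 0 (runningSup (fun s => -y s) t)) (Icc 0 b) := by
    refine LipschitzOnWith.of_dist_le_mul fun s hs t ht => ?_
    refine le_trans ?_ (h1.dist_le_mul s hs t ht)
    rw [Real.dist_eq, Real.dist_eq, max_comm (0 : ℝ), max_comm (0 : ℝ)]
    exact abs_max_sub_max_le_abs _ _ _
  rw [← uIcc_of_le hb] at h2
  exact (hy.contDiffOn.absolutelyContinuousOnInterval).add h2.absolutelyContinuousOnInterval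

/-- Where the reflected path is positive, the regulator is locally constant and the slope is `a`.
Where it vanishes, it has a local minimum, so its slope is 0; the monotone regulator then has slope
`-a ≥ 0`, whence `max 0 a = 0`. -/
theorem hasDerivAt_reflection (hy : Continuous y) {t a : ℝ} (ht : 0 < t)
    (hya : HasDerivAt y a t) (hd : DifferentiableAt ℝ (reflection y) t) :
    HasDerivAt (reflection y) (posPart a (reflection y t)) t := by
  have hn := hy.fun_neg
  unfold posPart
  split_ifs with hpos
  · have hev : ∀ᶠ s in 𝓝 t, max 0 (runningSup (fun s => -y s) s)
        = max 0 (runningSup (fun s => -y s) t) := by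
      rcases lt_or_ge (runningSup (fun s => -y s) t) 0 with hlt | hge
      · filter_upwards [(continuous_runningSup hn).continuousAt.eventually_lt_const hlt] with s hs
        rw [max_eq_left hs.le, max_eq_left hlt.le]
      · have : -y t < runningSup (fun s => -y s) t := by
          rw [reflection, max_eq_right hge] at hpos
          linarith
        filter_upwards [runningSup_eventually_eq hn ht this] with s hs
        rw [hs]
    refine (hya.add_const (max 0 (runningSup (fun s => -y s) t))).congr_of_eventuallyEq ?_
    filter_upwards [hev] with s hs
    rw [reflection, hs]
  · have h0 : reflection y t = 0 :=
      le_antisymm (not_lt.1 hpos) (reflection_nonneg hy ht.le)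
    have hmin : IsLocalMin (reflection y) t := by
      filter_upwards [lt_mem_nhds ht] with s hs
      rw [h0]
      exact reflection_nonneg hy hs.le
    have hd0 : HasDerivAt (reflection y) 0 t := by
      have := hd.hasDerivAt
      rwa [hmin.deriv_eq_zero] at this
    have hl : HasDerivAt (fun s => max 0 (runningSup (fun s => -y s) s)) (0 - a) t := by
      refine (hd0.sub hya).congr_of_eventuallyEq (Eventually.of_forall fun s => ?_)
      simp [reflection]
    have hmono : MonotoneOn (fun s => max 0 (runningSup (fun s => -y s) s)) (Ioi 0) :=
      fun s hs s' _ hss => max_le_max le_rfl (runningSup_mono hn (le_of_lt hs) hss)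
    have ha : 0 ≤ 0 - a := by
      rw [← hl.deriv, ← derivWithin_of_isOpen isOpen_Ioi (show t ∈ Ioi 0 from ht)]
      exact hmono.derivWithin_nonneg
    rwa [max_eq_left (by linarith)]

end Reflection

/-- Global solvability of `u' = Φ u` for a causal functional `Φ` that is Lipschitz in the
supremum norm on `[0, t]`, uniformly in `t ≤ T`. -/
theorem exists_hasDerivAt_of_causal_lipschitz {E : Type*} [NormedAddCommGroup E] [NormedSpace ℝ E]
    [CompleteSpace E] {T L : ℝ} (hT : 0 ≤ T) (hL0 : 0 ≤ L) (Φ : (ℝ → E) → ℝ → E)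
    (hΦ : ∀ u, Continuous u → Continuous (Φ u))
    (hL : ∀ u v, Continuous u → Continuous v → ∀ t ∈ Icc 0 T, ∀ c,
      (∀ s, 0 ≤ s → s ≤ t → ‖u s - v s‖ ≤ c) → ‖Φ u t - Φ v t‖ ≤ L * c) (z₀ : E) :
    ∃ u : ℝ → E, u 0 = z₀ ∧ ContDiff ℝ 1 u ∧ ∀ t ∈ Icc 0 T, HasDerivAt u (Φ u t) t := by
  have hTc : ∀ u : C(Icc 0 T, E), Continuous (IccExtend hT u) := fun u => u.continuous.Icc_extend'
  have hder : ∀ v : ℝ → E, Continuous v → ∀ t,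
      HasDerivAt (fun t => z₀ + ∫ s in (0 : ℝ)..t, v s) (v t) t := fun v hv t =>
    (intervalIntegral.integral_hasDerivAt_right (hv.intervalIntegrable _ _)
      (hv.stronglyMeasurableAtFilter _ _) hv.continuousAt).const_add _
  have hcont : ∀ u : ℝ → E, Continuous u →
      Continuous fun t => z₀ + ∫ s in (0 : ℝ)..t, Φ u s := fun u hu =>
    continuous_iff_continuousAt.2 fun t => (hder _ (hΦ u hu) t).continuousAt
  let next : C(Icc 0 T, E) → C(Icc 0 T, E) := fun u =>
    ⟨fun t => z₀ + ∫ s in (0 : ℝ)..t, Φ (IccExtend hT u) s,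
      (hcont _ (hTc u)).comp continuous_subtype_val⟩
  -- The factorial makes some iterate of `next` a contraction on the whole of `[0, T]`, however
  -- large `T` is.
  have hiter : ∀ (n : ℕ) (u v : C(Icc 0 T, E)) (t : Icc 0 T),
      ‖next^[n] u t - next^[n] v t‖ ≤ (L * t) ^ n / n.factorial * dist u v := by
    intro n u v
    induction n with
    | zero =>
      intro t
      simpa [dist_eq_norm] using ContinuousMap.norm_coe_le_norm (u - v) t
    | succ n ih =>
      intro t
      rw [Function.iterate_succ_apply', Function.iterate_succ_apply']
      set p := next^[n] u
      set q := next^[n] v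
      have hi : ∀ u : C(Icc 0 T, E),
          IntervalIntegrable (Φ (IccExtend hT u)) volume 0 (t : ℝ) := fun u =>
        (hΦ _ (hTc u)).intervalIntegrable _ _
      change ‖(z₀ + ∫ s in (0 : ℝ)..t, Φ (IccExtend hT p) s)
        - (z₀ + ∫ s in (0 : ℝ)..t, Φ (IccExtend hT q) s)‖ ≤ _
      rw [add_sub_add_left_eq_sub, ← intervalIntegral.integral_sub (hi p) (hi q)]
      have hb : ∀ s ∈ Ioc (0 : ℝ) t, ‖Φ (IccExtend hT p) s - Φ (IccExtend hT q) s‖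
          ≤ L * ((L * s) ^ n / n.factorial * dist u v) := by
        intro s hs
        refine hL _ _ (hTc p) (hTc q) s ⟨hs.1.le, hs.2.trans t.2.2⟩ _ fun r h0 hr => ?_
        have hrT : r ∈ Icc 0 T := ⟨h0, hr.trans (hs.2.trans t.2.2)⟩
        rw [IccExtend_of_mem hT _ hrT, IccExtend_of_mem hT _ hrT]
        refine (ih ⟨r, hrT⟩).trans ?_
        have h1 : L * r ≤ L * s := by gcongr
        have h2 : 0 ≤ L * r := by positivity
        gcongr
      refine (intervalIntegral.norm_integral_le_of_norm_le t.2.1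
        (Eventually.of_forall hb) (Continuous.intervalIntegrable (by fun_prop) _ _)).trans
        (le_of_eq ?_)
      have h1 : (fun s : ℝ => L * ((L * s) ^ n / n.factorial * dist u v))
          = fun s => (L ^ (n + 1) / n.factorial * dist u v) * s ^ n := by
        ext s; rw [mul_pow]; ring
      rw [h1, intervalIntegral.integral_const_mul, integral_pow, Nat.factorial_succ]
      push_cast
      have : (n.factorial : ℝ) ≠ 0 := by positivity
      have : (n : ℝ) + 1 ≠ 0 := by positivity
      rw [mul_pow]
      field_simp
      simp
  obtain ⟨n, hn⟩ := (FloorSemiring.tendsto_pow_div_factorial_atTop (L * T)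
    |>.eventually (gt_mem_nhds zero_lt_one)).exists
  have hn0 : 0 ≤ (L * T) ^ n / (n.factorial : ℝ) := by positivity
  have hcontr : ContractingWith (NNReal.mk _ hn0) next^[n] := by
    refine ⟨hn, LipschitzWith.of_dist_le_mul fun u v => ?_⟩
    rw [dist_eq_norm, ContinuousMap.norm_le _ (by positivity)]
    intro t
    refine (hiter n u v t).trans ?_
    have h1 : L * t ≤ L * T := by gcongr; exact t.2.2
    have h2 : 0 ≤ L * (t : ℝ) := mul_nonneg hL0 t.2.1
    rw [NNReal.coe_mk]
    gcongr
  have hfix := hcontr.isFixedPt_fixedPoint_iterate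
  set p := ContractingWith.fixedPoint _ hcontr
  have hp : ∀ t ∈ Icc 0 T, IccExtend hT p t = z₀ + ∫ s in (0 : ℝ)..t, Φ (IccExtend hT p) s := by
    intro t ht
    rw [IccExtend_of_mem hT _ ht]
    exact (DFunLike.congr_fun hfix ⟨t, ht⟩).symm
  refine ⟨fun t => z₀ + ∫ s in (0 : ℝ)..t, Φ (IccExtend hT p) s, by simp, ?_, fun t ht => ?_⟩
  · rw [contDiff_one_iff_deriv]
    refine ⟨fun t => (hder _ (hΦ _ (hTc p)) t).differentiableAt, ?_⟩
    rw [funext fun t => (hder _ (hΦ _ (hTc p)) t).deriv]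
    exact hΦ _ (hTc p)
  -- The fixed point and its integral formula agree on `[0, t]` but may differ beyond `T`; causality
  -- with `c = 0` identifies their images under `Φ` at `t`.
  · have h := hL (IccExtend hT p) _ (hTc p) (hcont _ (hTc p)) t ht 0 fun s h0 hs => by
      rw [hp s ⟨h0, hs.trans ht.2⟩, sub_self, norm_zero]
    rw [mul_zero, norm_le_zero_iff, sub_eq_zero] at h
    rw [← h]
    exact hder _ (hΦ _ (hTc p)) t

/-! ### Absolutely continuous functions and the gradient inequality. -/

theorem _root_.AbsolutelyContinuousOnInterval.comp_lipschitzWith {X Y : Type*} [PseudoMetricSpace X]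
    [PseudoMetricSpace Y] {γ : ℝ → X} {φ : X → Y} {a b : ℝ} {K : ℝ≥0}
    (hγ : AbsolutelyContinuousOnInterval γ a b) (hφ : LipschitzWith K φ) :
    AbsolutelyContinuousOnInterval (fun t => φ (γ t)) a b := by
  refine squeeze_zero (fun E => Finset.sum_nonneg fun _ _ => dist_nonneg) (fun E => ?_)
    (by simpa using Tendsto.const_mul (K : ℝ) hγ)
  rw [Finset.mul_sum]
  exact Finset.sum_le_sum fun i _ => hφ.dist_le_mul _ _

theorem _root_.AbsolutelyContinuousOnInterval.congr {X : Type*} [PseudoMetricSpace X]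
    {γ η : ℝ → X} {a b : ℝ} (hγ : AbsolutelyContinuousOnInterval γ a b)
    (h : EqOn γ η (uIcc a b)) : AbsolutelyContinuousOnInterval η a b := by
  rw [absolutelyContinuousOnInterval_iff] at *
  intro ε hε
  obtain ⟨δ, hδ, H⟩ := hγ ε hε
  refine ⟨δ, hδ, fun E hE hlt => ?_⟩
  convert H E hE hlt using 1
  exact Finset.sum_congr rfl fun i hi => by rw [h (hE.1 i hi).1, h (hE.1 i hi).2]

theorem le_of_ae_hasDerivAt_nonpos {u : ℝ → ℝ} {b : ℝ} (hb : 0 ≤ b)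
    (hu : AbsolutelyContinuousOnInterval u 0 b)
    (h : ∀ᵐ t : ℝ, t ∈ Ioo 0 b → ∃ u', HasDerivAt u u' t ∧ u' ≤ 0) : u b ≤ u 0 := by
  rw [← sub_nonpos, ← hu.integral_deriv_eq_sub, intervalIntegral.integral_of_le hb,
    integral_Ioc_eq_integral_Ioo]
  refine setIntegral_nonpos_ae measurableSet_Ioo ?_
  filter_upwards [h] with t ht hmem
  obtain ⟨u', h1, h2⟩ := ht hmem
  rwa [h1.deriv]

theorem _root_.ConvexOn.add_inner_gradient_le {E : Type*} [NormedAddCommGroup E]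
    [InnerProductSpace ℝ E] [CompleteSpace E] {h : E → ℝ} (hc : ConvexOn ℝ univ h) {x : E}
    (hd : DifferentiableAt ℝ h x) (y : E) : h x + ⟪gradient h x, y - x⟫ ≤ h y := by
  have hc' := hc.comp_affineMap (AffineMap.lineMap x y : ℝ →ᵃ[ℝ] E)
  have hder : HasDerivAt (h ∘ (AffineMap.lineMap x y : ℝ →ᵃ[ℝ] E)) (fderiv ℝ h x (y - x)) 0 := by
    refine HasFDerivAt.comp_hasDerivAt 0 ?_ AffineMap.hasDerivAt_lineMap
    simpa using hd.hasFDerivAt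
  have := hc'.le_slope_of_hasDerivAt (mem_univ 0) (mem_univ 1) zero_lt_one hder
  rw [inner_gradient_left]
  simp only [slope_def_field, Function.comp_apply, AffineMap.lineMap_apply_zero,
    AffineMap.lineMap_apply_one, sub_zero, div_one] at this
  linarith

/-! ### Dissipativity and its consequences for solutions. -/

theorem le_posPart (a b : ℝ) : a ≤ posPart a b := by
  unfold posPart; split_ifs <;> simp

theorem posPart_mul (a : ℝ) {b : ℝ} (hb : 0 ≤ b) : posPart a b * b = a * b := by
  unfold posPart
  split_ifs with h
  · rfl
  · simp [le_antisymm (not_lt.1 h) hb]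

/-- The projection leaves the diagonal products `a * b` and `a' * b'` unchanged, and only lowers the
cross terms `-a * b'` and `-a' * b`. -/
theorem posPart_sub_mul_sub_le (a a' : ℝ) {b b' : ℝ} (hb : 0 ≤ b) (hb' : 0 ≤ b') :
    (posPart a b - posPart a' b') * (b - b') ≤ (a - a') * (b - b') := by
  have h1 := posPart_mul a hb
  have h2 := posPart_mul a' hb'
  have h3 := mul_le_mul_of_nonneg_right (le_posPart a b) hb'
  have h4 := mul_le_mul_of_nonneg_right (le_posPart a' b') hb
  linarith

/-- The Euclidean inner product on `ℝⁿ × ℝᵐ`. -/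
noncomputable def dot {n m : ℕ} (z w : State n m) : ℝ := ⟪z.1, w.1⟫ + ⟪z.2, w.2⟫

section

variable {n m : ℕ} {f : EuclideanSpace ℝ (Fin n) → ℝ}
  {g : EuclideanSpace ℝ (Fin n) → EuclideanSpace ℝ (Fin m)}

theorem dot_sub_left (u v w : State n m) : dot (u - v) w = dot u w - dot v w := by
  simp only [dot, Prod.fst_sub, Prod.snd_sub, inner_sub_left]
  ring

/-- The primal-dual vector field is dissipative. -/
theorem dot_field_sub_nonpos (hf : Differentiable ℝ f) (hg : Differentiable ℝ g)
    (hfconc : ConcaveOn ℝ univ f) (hgconv : ∀ i, ConvexOn ℝ univ (fun x => g x i))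
    {z w : State n m} (hz : z ∈ domain n m) (hw : w ∈ domain n m) :
    dot (field f g z - field f g w) (z - w) ≤ 0 := by
  have hgi : ∀ i, Differentiable ℝ fun x => g x i := fun i => by fun_prop
  have hfg : ∀ x, gradient (-f) x = -gradient f x := fun x => by
    refine ext_inner_right ℝ fun v => ?_
    rw [inner_neg_left, inner_gradient_left, inner_gradient_left, fderiv_neg]
    rfl
  have h1 := hfconc.neg.add_inner_gradient_le (hf z.1).neg w.1
  have h2 := hfconc.neg.add_inner_gradient_le (hf w.1).neg z.1
  rw [hfg, inner_neg_left, Pi.neg_apply, Pi.neg_apply] at h1 h2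
  have hneg : ∀ v : EuclideanSpace ℝ (Fin n), ⟪v, w.1 - z.1⟫ = -⟪v, z.1 - w.1⟫ := fun v => by
    rw [← inner_neg_right, neg_sub]
  rw [hneg] at h1
  -- For each constraint, the two gradient inequalities weighted by the multipliers bound the primal
  -- terms by `-(g z.1 i - g w.1 i) * (z.2 i - w.2 i)`, which cancels the bound on the dual term.
  have hsum : ∑ i, (-(z.2 i * ⟪gradient (fun y => g y i) z.1, z.1 - w.1⟫)
      + w.2 i * ⟪gradient (fun y => g y i) w.1, z.1 - w.1⟫
      + (posPart (g z.1 i) (z.2 i) - posPart (g w.1 i) (w.2 i)) * (z.2 i - w.2 i)) ≤ 0 := by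
    refine Finset.sum_nonpos fun i _ => ?_
    have h3 := (hgconv i).add_inner_gradient_le (hgi i z.1) w.1
    have h4 := (hgconv i).add_inner_gradient_le (hgi i w.1) z.1
    rw [hneg] at h3
    have h5 := mul_le_mul_of_nonneg_left h3 (hz i)
    have h6 := mul_le_mul_of_nonneg_left h4 (hw i)
    have h7 := posPart_sub_mul_sub_le (g z.1 i) (g w.1 i) (hz i) (hw i)
    linarith
  rw [Finset.sum_add_distrib, Finset.sum_add_distrib, Finset.sum_neg_distrib] at hsum
  have hmul : ∀ a b : ℝ, ⟪a, b⟫ = a * b := fun a b => by simp [mul_comm]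
  have hexp : dot (field f g z - field f g w) (z - w)
      = ⟪gradient f z.1, z.1 - w.1⟫ - ⟪gradient f w.1, z.1 - w.1⟫
        - ∑ i, z.2 i * ⟪gradient (fun y => g y i) z.1, z.1 - w.1⟫
        + ∑ i, w.2 i * ⟪gradient (fun y => g y i) w.1, z.1 - w.1⟫
        + ∑ i, (posPart (g z.1 i) (z.2 i) - posPart (g w.1 i) (w.2 i)) * (z.2 i - w.2 i) := by
    have hdual : ⟪(field f g z - field f g w).2, (z - w).2⟫
        = ∑ i, (posPart (g z.1 i) (z.2 i) - posPart (g w.1 i) (w.2 i)) * (z.2 i - w.2 i) := by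
      rw [PiLp.inner_apply]
      exact Finset.sum_congr rfl fun i _ => hmul _ _
    rw [dot, hdual]
    simp only [field, Prod.fst_sub, inner_sub_left, sum_inner, real_inner_smul_left]
    ring
  rw [hexp]
  linarith

theorem hasDerivAt_V {γ η : ℝ → State n m} {γ' η' : State n m} {t : ℝ} (hγ : HasDerivAt γ γ' t)
    (hη : HasDerivAt η η' t) :
    HasDerivAt (fun s => V (η s) (γ s)) (dot (γ' - η') (γ t - η t)) t := by
  have h1 := (hasFDerivAt_fst.comp_hasDerivAt t (hγ.sub hη)).norm_sq
  have h2 := (hasFDerivAt_snd.comp_hasDerivAt t (hγ.sub hη)).norm_sq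
  convert! (h1.add h2).const_mul (1 / 2 : ℝ) using 1
  change ⟪(γ' - η').1, (γ t - η t).1⟫ + ⟪(γ' - η').2, (γ t - η t).2⟫
    = 1 / 2 * (2 * ⟪(γ t - η t).1, (γ' - η').1⟫ + 2 * ⟪(γ t - η t).2, (γ' - η').2⟫)
  rw [real_inner_comm, real_inner_comm (γ t - η t).2]
  ring

theorem absolutelyContinuousOnInterval_V {γ η : ℝ → State n m} {a b : ℝ}
    (hγ : AbsolutelyContinuousOnInterval γ a b) (hη : AbsolutelyContinuousOnInterval η a b) :
    AbsolutelyContinuousOnInterval (fun s => V (η s) (γ s)) a b := by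
  have h1 := ((hγ.sub hη).comp_lipschitzWith LipschitzWith.prod_fst).comp_lipschitzWith
    lipschitzWith_one_norm
  have h2 := ((hγ.sub hη).comp_lipschitzWith LipschitzWith.prod_snd).comp_lipschitzWith
    lipschitzWith_one_norm
  refine (((h1.mul h1).add (h2.mul h2)).const_mul (1 / 2)).congr fun t _ => ?_
  simp [V, sq]

theorem V_nonneg (z w : State n m) : 0 ≤ V z w := by unfold V; positivity

/-- The norm on `State n m` is the maximum of the two Euclidean norms, so it is comparable with `V`
only up to constants. -/
theorem norm_sub_sq_le_V (z w : State n m) : ‖w - z‖ ^ 2 ≤ 2 * V z w := by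
  have h1 := sq_nonneg ‖w.1 - z.1‖
  have h2 := sq_nonneg ‖w.2 - z.2‖
  unfold V
  rcases max_choice ‖(w - z).1‖ ‖(w - z).2‖ with h | h <;> rw [Prod.norm_def, h] <;>
    simp only [Prod.fst_sub, Prod.snd_sub] <;> linarith

theorem eq_of_V_nonpos {z w : State n m} (h : V z w ≤ 0) : w = z := by
  have h1 := norm_sub_sq_le_V z w
  have h2 : ‖w - z‖ ^ 2 = 0 := le_antisymm (by linarith) (by positivity)
  simpa [sub_eq_zero] using h2

theorem V_self (z : State n m) : V z z = 0 := by simp [V]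

theorem V_le_dist_sq (z w : State n m) : V z w ≤ dist w z ^ 2 := by
  have h1 : ‖w.1 - z.1‖ ≤ ‖w - z‖ := norm_fst_le (w - z)
  have h2 : ‖w.2 - z.2‖ ≤ ‖w - z‖ := norm_snd_le (w - z)
  have h3 : ‖w.1 - z.1‖ ^ 2 ≤ ‖w - z‖ ^ 2 := by gcongr
  have h4 : ‖w.2 - z.2‖ ^ 2 ≤ ‖w - z‖ ^ 2 := by gcongr
  rw [dist_eq_norm]
  unfold V
  linarith

/-- `γ` solves `γ' = F γ` on `[0, b]` in the sense of Carathéodory and stays in `D`. -/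
def SolvesOn {E : Type*} [NormedAddCommGroup E] [NormedSpace ℝ E] (D : Set E) (F : E → E) (b : ℝ)
    (γ : ℝ → E) : Prop :=
  AbsolutelyContinuousOnInterval γ 0 b ∧
    ∀ᵐ t : ℝ, t ∈ Ioo 0 b → γ t ∈ D ∧ HasDerivAt γ (F (γ t)) t

theorem IsCaratheodorySolution.solvesOn {E : Type*} [NormedAddCommGroup E] [NormedSpace ℝ E]
    {D : Set E} {F : E → E} {T : EReal} {γ : ℝ → E} (h : IsCaratheodorySolution D F T γ) {b : ℝ}
    (hb : 0 ≤ b) (hbT : (b : EReal) < T) : SolvesOn D F b γ := by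
  refine ⟨h.1 b hb hbT, ?_⟩
  filter_upwards [h.2] with t ht hmem
  exact ht hmem.1.le ((EReal.coe_lt_coe_iff.2 hmem.2).trans hbT)

theorem SolvesOn.mono {E : Type*} [NormedAddCommGroup E] [NormedSpace ℝ E]
    {D : Set E} {F : E → E} {b c : ℝ} {γ : ℝ → E} (h : SolvesOn D F b γ) (hc : 0 ≤ c)
    (hcb : c ≤ b) : SolvesOn D F c γ := by
  refine ⟨h.1.mono ?_, ?_⟩
  · rw [uIcc_of_le hc, uIcc_of_le (hc.trans hcb)]
    exact Icc_subset_Icc_right hcb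
  · filter_upwards [h.2] with t ht hmem
    exact ht ⟨hmem.1, hmem.2.trans_le hcb⟩

theorem V_antitone_of_solvesOn (hf : Differentiable ℝ f) (hg : Differentiable ℝ g)
    (hfconc : ConcaveOn ℝ univ f) (hgconv : ∀ i, ConvexOn ℝ univ (fun x => g x i))
    {γ η : ℝ → State n m} {b : ℝ} (hb : 0 ≤ b) (hγ : SolvesOn (domain n m) (field f g) b γ)
    (hη : SolvesOn (domain n m) (field f g) b η) : V (η b) (γ b) ≤ V (η 0) (γ 0) := by
  refine le_of_ae_hasDerivAt_nonpos (u := fun t => V (η t) (γ t)) hb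
    (absolutelyContinuousOnInterval_V hγ.1 hη.1) ?_
  filter_upwards [hγ.2, hη.2] with t h1 h2 ht
  exact ⟨_, hasDerivAt_V (h1 ht).2 (h2 ht).2,
    dot_field_sub_nonpos hf hg hfconc hgconv (h1 ht).1 (h2 ht).1⟩

theorem dot_le_add (u v : State n m) : dot u v ≤ V 0 u + V 0 v := by
  have h1 := real_inner_le_norm u.1 v.1
  have h2 := real_inner_le_norm u.2 v.2
  have h3 := two_mul_le_add_sq ‖u.1‖ ‖v.1‖
  have h4 := two_mul_le_add_sq ‖u.2‖ ‖v.2‖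
  simp only [dot, V, Prod.fst_zero, Prod.snd_zero, sub_zero]
  linarith

/-- A priori bound that excludes blow-up in finite time. -/
theorem V_le_of_solvesOn (hf : Differentiable ℝ f) (hg : Differentiable ℝ g)
    (hfconc : ConcaveOn ℝ univ f) (hgconv : ∀ i, ConvexOn ℝ univ (fun x => g x i))
    {γ : ℝ → State n m} {b : ℝ} (hb : 0 ≤ b) (hγ : SolvesOn (domain n m) (field f g) b γ)
    (h0 : γ 0 ∈ domain n m) :
    V (γ 0) (γ b) ≤ V 0 (field f g (γ 0)) * b * Real.exp b := by
  set C := V 0 (field f g (γ 0)) with hC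
  have hac := absolutelyContinuousOnInterval_V hγ.1
    (LipschitzWith.const (γ 0)).lipschitzOnWith.absolutelyContinuousOnInterval
  have hexp : AbsolutelyContinuousOnInterval (fun t : ℝ => Real.exp (-t)) 0 b :=
    (ContDiff.contDiffOn (by fun_prop)).absolutelyContinuousOnInterval
  have hlin : AbsolutelyContinuousOnInterval (fun t : ℝ => C * t) 0 b :=
    (ContDiff.contDiffOn (by fun_prop)).absolutelyContinuousOnInterval
  -- Dissipativity against the fixed point `γ 0` gives `V' ≤ C + V`; the integrating factor `exp
  -- (-t)` makes this Gronwall.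
  have key := le_of_ae_hasDerivAt_nonpos
    (u := fun t => Real.exp (-t) * V (γ 0) (γ t) - C * t) hb ((hexp.mul hac).sub hlin) ?_
  · simp only [V_self, mul_zero, sub_zero] at key
    have h1 : Real.exp (-b) * V (γ 0) (γ b) ≤ C * b := by linarith
    have h2 := mul_le_mul_of_nonneg_left h1 (Real.exp_pos b).le
    rw [← mul_assoc, ← Real.exp_add, add_neg_cancel, Real.exp_zero, one_mul] at h2
    linarith
  · filter_upwards [hγ.2] with t h1 ht
    obtain ⟨hD, hder⟩ := h1 ht
    have hV := hasDerivAt_V hder (hasDerivAt_const t (γ 0))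
    refine ⟨_, (((hasDerivAt_neg t).exp).mul hV).sub ((hasDerivAt_id t).const_mul C), ?_⟩
    have h2 := dot_field_sub_nonpos hf hg hfconc hgconv hD h0
    rw [dot_sub_left] at h2
    have h3 := dot_le_add (field f g (γ 0)) (γ t - γ 0)
    have h4 : V 0 (γ t - γ 0) = V (γ 0) (γ t) := by simp [V]
    rw [h4, ← hC] at h3
    have h5 : dot (field f g (γ t)) (γ t - γ 0) - V (γ 0) (γ t) ≤ C := by linarith
    have h6 := mul_le_mul_of_nonneg_left h5 (Real.exp_pos (-t)).le
    have h7 : Real.exp (-t) * C ≤ 1 * C :=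
      mul_le_mul_of_nonneg_right (Real.exp_le_one_iff.2 (by linarith [ht.1])) (V_nonneg _ _)
    simp only [sub_zero]
    linarith

/-- Maximality in `x` gives stationarity. Changing one multiplier gives `g i ≤ 0` (increase by 1)
and complementary slackness (decrease to 0). -/
theorem field_eq_zero_of_isSaddle (hf : Differentiable ℝ f) (hg : Differentiable ℝ g)
    {zs : State n m} (h : IsSaddle f g zs) : field f g zs = 0 := by
  obtain ⟨hD, hx, hl⟩ := h
  have hgi : ∀ i, Differentiable ℝ fun x => g x i := fun i => by fun_prop
  refine Prod.ext ?_ ?_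
  · have hmax : IsLocalMax (fun x => lagrangian f g (x, zs.2)) zs.1 :=
      Eventually.of_forall hx
    have hd : HasFDerivAt (fun x => lagrangian f g (x, zs.2))
        (fderiv ℝ f zs.1 - ∑ i, zs.2 i • fderiv ℝ (fun y => g y i) zs.1) zs.1 :=
      (hf zs.1).hasFDerivAt.sub (HasFDerivAt.fun_sum fun i _ =>
        ((hgi i zs.1).hasFDerivAt.const_mul (zs.2 i)))
    have h0 := hmax.hasFDerivAt_eq_zero hd
    refine ext_inner_right ℝ fun v => ?_
    have := DFunLike.congr_fun h0 v
    simpa [field, inner_sub_left, sum_inner, real_inner_smul_left, inner_gradient_left] using this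
  · have hpert : ∀ (i : Fin m) (c : ℝ), 0 ≤ zs.2 i + c → c * g zs.1 i ≤ 0 := by
      intro i c hc
      have h1 := hl (zs.2 + EuclideanSpace.single i c) fun j => by
        rcases eq_or_ne j i with rfl | hj
        · simpa using hc
        · simpa [hj] using hD j
      simp only [lagrangian, PiLp.add_apply, add_mul, Finset.sum_add_distrib] at h1
      have h2 : ∑ j, (EuclideanSpace.single i c : EuclideanSpace ℝ (Fin m)) j * g zs.1 j
          = c * g zs.1 i := by
        simp [PiLp.single_apply, ite_mul]
      linarith
    ext i
    have h1 := hpert i 1 (by linarith [hD i])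
    simp only [field, posPart, Prod.snd_zero, PiLp.zero_apply]
    split_ifs with hpos
    · have h2 := hpert i (-zs.2 i) (by simp)
      nlinarith
    · exact max_eq_left (by linarith)

end

/-! ### Existence for a globally Lipschitz field, by reflection. -/

theorem norm_euclidean_le_sum {m : ℕ} (x : EuclideanSpace ℝ (Fin m)) : ‖x‖ ≤ ∑ i, |x i| := by
  have h := (EuclideanSpace.basisFun (Fin m) ℝ).sum_repr x
  calc ‖x‖ = ‖∑ i, (EuclideanSpace.basisFun (Fin m) ℝ).repr x i
        • EuclideanSpace.basisFun (Fin m) ℝ i‖ := by rw [h]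
    _ ≤ _ := norm_sum_le _ _
    _ = ∑ i, |x i| := by simp [norm_smul]

theorem absolutelyContinuousOnInterval_of_coord {n m : ℕ} {γ : ℝ → State n m} {a b : ℝ}
    (h1 : AbsolutelyContinuousOnInterval (fun t => (γ t).1) a b)
    (h2 : ∀ i, AbsolutelyContinuousOnInterval (fun t => (γ t).2 i) a b) :
    AbsolutelyContinuousOnInterval γ a b := by
  refine squeeze_zero (fun E => Finset.sum_nonneg fun _ _ => dist_nonneg) (fun E => ?_)
    (by simpa using Tendsto.add h1 (tendsto_finsetSum Finset.univ fun i _ => h2 i))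
  rw [Finset.sum_comm, ← Finset.sum_add_distrib]
  refine Finset.sum_le_sum fun k _ => ?_
  have h3 := norm_euclidean_le_sum ((γ (E.2 k).1).2 - (γ (E.2 k).2).2)
  rw [Prod.dist_eq, dist_eq_norm (γ (E.2 k).1).2]
  refine max_le_add_of_nonneg dist_nonneg (norm_nonneg _) |>.trans ?_
  simp only [Real.dist_eq]
  gcongr
  exact h3

theorem hasDerivAt_of_coord {n m : ℕ} {γ : ℝ → State n m} {γ' : State n m} {t : ℝ}
    (h1 : HasDerivAt (fun t => (γ t).1) γ'.1 t)
    (h2 : ∀ i, HasDerivAt (fun t => (γ t).2 i) (γ'.2 i) t) : HasDerivAt γ γ' t := by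
  have h3 : HasDerivAt (fun t => (γ t).2) γ'.2 t :=
    (PiLp.continuousLinearEquiv 2 ℝ fun _ : Fin m => ℝ).symm.hasFDerivAt.comp_hasDerivAt t
      (hasDerivAt_pi.2 h2)
  exact h1.prodMk h3

/-- The path `(x, λ)` obtained from `(x, y)` by reflecting the coordinates of `y` at `0`. -/
noncomputable def reflectPath {n m : ℕ} (u : ℝ → State n m) (t : ℝ) : State n m :=
  ((u t).1, WithLp.toLp 2 fun i => reflection (fun s => (u s).2 i) t)

theorem continuous_reflectPath {n m : ℕ} {u : ℝ → State n m} (hu : Continuous u) :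
    Continuous (reflectPath u) := by
  have h : ∀ i, Continuous (reflection fun s => (u s).2 i) := fun i =>
    continuous_reflection (by fun_prop)
  unfold reflectPath
  fun_prop

theorem norm_reflectPath_sub_le {n m : ℕ} {u v : ℝ → State n m} (hu : Continuous u)
    (hv : Continuous v) {t c : ℝ} (ht : 0 ≤ t) (h : ∀ s, 0 ≤ s → s ≤ t → ‖u s - v s‖ ≤ c) :
    ‖reflectPath u t - reflectPath v t‖ ≤ (1 + 2 * m) * c := by
  have hc : 0 ≤ c := (norm_nonneg _).trans (h t ht le_rfl)
  have h1 : ‖(u t).1 - (v t).1‖ ≤ c := (norm_fst_le (u t - v t)).trans (h t ht le_rfl)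
  have h2 : ∀ i, |reflection (fun s => (u s).2 i) t - reflection (fun s => (v s).2 i) t|
      ≤ 2 * c := fun i => by
    refine abs_reflection_sub_le (by fun_prop) (by fun_prop) ht fun s h0 hs => ?_
    refine le_trans ?_ (h s h0 hs)
    exact (PiLp.norm_apply_le (u s - v s).2 i).trans (norm_snd_le _)
  have h3 := (norm_euclidean_le_sum ((reflectPath u t).2 - (reflectPath v t).2)).trans
    (Finset.sum_le_sum fun i _ => h2 i)
  rw [Finset.sum_const, Finset.card_univ, Fintype.card_fin, nsmul_eq_mul] at h3
  have h4 : 0 ≤ (m : ℝ) * (2 * c) := by positivity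
  refine max_le ?_ ?_
  · change ‖(u t).1 - (v t).1‖ ≤ _
    linarith
  · change ‖(reflectPath u t).2 - (reflectPath v t).2‖ ≤ _
    linarith

/-- The projection of a vector field `H` onto the tangent directions of `domain n m`. -/
noncomputable def projectedField {n m : ℕ} (H : State n m → State n m) (z : State n m) :
    State n m :=
  ((H z).1, WithLp.toLp 2 fun i => posPart ((H z).2 i) (z.2 i))

/-- Only the unprojected path `u` is obtained from a fixed point; the discontinuous projection
appears afterwards, when the reflected coordinates are differentiated almost everywhere. -/
theorem exists_solvesOn_projectedField {n m : ℕ} {H : State n m → State n m} {K : ℝ≥0}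
    (hH : LipschitzWith K H) {b : ℝ} (hb : 0 ≤ b) {z₀ : State n m} (hz₀ : z₀ ∈ domain n m) :
    ∃ γ : ℝ → State n m, γ 0 = z₀ ∧ Continuous γ ∧ (∀ t, 0 ≤ t → γ t ∈ domain n m) ∧
      SolvesOn (domain n m) (projectedField H) b γ := by
  obtain ⟨u, hu0, hu, hder⟩ := exists_hasDerivAt_of_causal_lipschitz hb
    (L := K * (1 + 2 * m)) (by positivity) (fun u t => H (reflectPath u t))
    (fun u hu => hH.continuous.comp (continuous_reflectPath hu))
    (fun u v hu hv t ht c h => by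
      rw [mul_assoc]
      exact (hH.norm_sub_le _ _).trans
        (mul_le_mul_of_nonneg_left (norm_reflectPath_sub_le hu hv ht.1 h) K.2)) z₀
  have huc : ∀ i, ContDiff ℝ 1 fun s => (u s).2 i := fun i => by fun_prop
  have hnonneg : ∀ t, 0 ≤ t → reflectPath u t ∈ domain n m := fun t ht i =>
    reflection_nonneg (huc i).continuous ht
  have hac : ∀ i, AbsolutelyContinuousOnInterval (fun t => (reflectPath u t).2 i) 0 b := fun i =>
    absolutelyContinuousOnInterval_reflection (huc i) hb
  refine ⟨reflectPath u, ?_, continuous_reflectPath hu.continuous, hnonneg,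
    absolutelyContinuousOnInterval_of_coord ?_ hac, ?_⟩
  · refine Prod.ext (congrArg (fun z : State n m => z.1) hu0 :) ?_
    ext i
    have h0 : (u 0).2 i = z₀.2 i := by rw [hu0]
    exact (reflection_zero (y := fun s => (u s).2 i) (h0 ▸ hz₀ i)).trans h0
  · exact ContDiffOn.absolutelyContinuousOnInterval (ContDiff.contDiffOn (by
      change ContDiff ℝ 1 fun t => (u t).1
      fun_prop))
  · filter_upwards [ae_all_iff.2 fun i => (hac i).ae_differentiableAt] with t hd ht
    have htI : t ∈ Icc 0 b := ⟨ht.1.le, ht.2.le⟩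
    have h := hder t htI
    have h1 : HasDerivAt (fun s => (u s).1) (H (reflectPath u t)).1 t :=
      (ContinuousLinearMap.fst ℝ (EuclideanSpace ℝ (Fin n))
        (EuclideanSpace ℝ (Fin m))).hasFDerivAt.comp_hasDerivAt t h
    have h2 : HasDerivAt (fun s => (u s).2) (H (reflectPath u t)).2 t :=
      (ContinuousLinearMap.snd ℝ (EuclideanSpace ℝ (Fin n))
        (EuclideanSpace ℝ (Fin m))).hasFDerivAt.comp_hasDerivAt t h
    refine ⟨hnonneg t ht.1.le, hasDerivAt_of_coord h1 fun i => ?_⟩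
    refine hasDerivAt_reflection (huc i).continuous ht.1 ?_ (hd i (uIcc_of_le hb ▸ htI))
    exact (EuclideanSpace.proj i : EuclideanSpace ℝ (Fin m) →L[ℝ] ℝ).hasFDerivAt.comp_hasDerivAt t h2

/-! ### Existence for the primal-dual field on `[0, ∞)`. -/

theorem _root_.LocallyLipschitz.smul_of_real {X E : Type*} [PseudoEMetricSpace X]
    [NormedAddCommGroup E] [NormedSpace ℝ E] {φ : X → ℝ} {ψ : X → E} (hφ : LocallyLipschitz φ)
    (hψ : LocallyLipschitz ψ) : LocallyLipschitz fun x => φ x • ψ x := by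
  have h : ContDiff ℝ 1 fun p : ℝ × E => p.1 • p.2 := by fun_prop
  exact h.locallyLipschitz.comp (hφ.prodMk hψ)

/-- The right-hand side of the primal-dual dynamics without projection. -/
noncomputable def unprojectedField {n m : ℕ} (f : EuclideanSpace ℝ (Fin n) → ℝ)
    (g : EuclideanSpace ℝ (Fin n) → EuclideanSpace ℝ (Fin m)) (z : State n m) : State n m :=
  (gradient f z.1 - ∑ i, z.2 i • gradient (fun y => g y i) z.1, g z.1)

section

variable {n m : ℕ} {f : EuclideanSpace ℝ (Fin n) → ℝ}
  {g : EuclideanSpace ℝ (Fin n) → EuclideanSpace ℝ (Fin m)}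

theorem locallyLipschitz_unprojectedField (hg : ContDiff ℝ 1 g)
    (hfLip : LocallyLipschitz (fun x => gradient f x))
    (hgLip : ∀ i, LocallyLipschitz (fun x => gradient (fun y => g y i) x)) :
    LocallyLipschitz (unprojectedField f g) := by
  have hfst : LocallyLipschitz (Prod.fst : State n m → _) := LipschitzWith.prod_fst.locallyLipschitz
  have hterm : ∀ i, LocallyLipschitz fun z : State n m =>
      z.2 i • gradient (fun y => g y i) z.1 := fun i => by
    have h1 : LocallyLipschitz fun z : State n m => z.2 i :=
      ((EuclideanSpace.proj i : EuclideanSpace ℝ (Fin m) →L[ℝ] ℝ).lipschitz.comp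
        LipschitzWith.prod_snd).locallyLipschitz
    have h2 : LocallyLipschitz fun z : State n m => gradient (fun y => g y i) z.1 :=
      (hgLip i).comp hfst
    exact h1.smul_of_real h2
  have hsum : ∀ s : Finset (Fin m), LocallyLipschitz fun z : State n m =>
      ∑ i ∈ s, z.2 i • gradient (fun y => g y i) z.1 := fun s => by
    induction s using Finset.induction_on with
    | empty => simpa using LocallyLipschitz.const _
    | insert i s hi ih =>
      simp only [Finset.sum_insert hi]
      exact (hterm i).add ih
  have h1 : LocallyLipschitz fun z : State n m => gradient f z.1 := hfLip.comp hfst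
  have h2 : LocallyLipschitz fun z : State n m => g z.1 := hg.locallyLipschitz.comp hfst
  exact (h1.sub (hsum Finset.univ)).prodMk h2

theorem exists_solvesOn_field (hf : Differentiable ℝ f) (hg : ContDiff ℝ 1 g)
    (hfconc : ConcaveOn ℝ univ f) (hgconv : ∀ i, ConvexOn ℝ univ (fun x => g x i))
    (hfLip : LocallyLipschitz (fun x => gradient f x))
    (hgLip : ∀ i, LocallyLipschitz (fun x => gradient (fun y => g y i) x))
    {b : ℝ} (hb : 0 ≤ b) {z₀ : State n m} (hz₀ : z₀ ∈ domain n m) :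
    ∃ γ : ℝ → State n m, γ 0 = z₀ ∧ (∀ t, 0 ≤ t → γ t ∈ domain n m) ∧
      SolvesOn (domain n m) (field f g) b γ := by
  set C := V 0 (field f g z₀) with hC
  have hC0 : 0 ≤ C := V_nonneg _ _
  -- The a priori bound gives `d ^ 2 ≤ 2 * (C * b * exp b)` for `d = ‖γ t - z₀‖`, and `d < 1 + d ^
  -- 2`; hence `‖γ t‖ < R`.
  set R := ‖z₀‖ + 1 + 2 * (C * b * Real.exp b) with hR
  obtain ⟨K, hK⟩ := ((locallyLipschitz_unprojectedField hg hfLip hgLip).locallyLipschitzOn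
    (s := Metric.closedBall 0 R)).exists_lipschitzOnWith_of_compact (isCompact_closedBall 0 R)
  obtain ⟨H, hH, hHeq⟩ := hK.extend_finite_dimension
  obtain ⟨γ, h0, hγc, hγD, hγ⟩ := exists_solvesOn_projectedField hH hb hz₀
  have hsolves : ∀ c, 0 ≤ c → c ≤ b → (∀ t ∈ Ioo 0 c, ‖γ t‖ ≤ R) →
      SolvesOn (domain n m) (field f g) c γ := by
    intro c hc hcb hbd
    obtain ⟨h1, h2⟩ := hγ.mono hc hcb
    refine ⟨h1, ?_⟩
    filter_upwards [h2] with t ht hmem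
    obtain ⟨hD, hder⟩ := ht hmem
    refine ⟨hD, ?_⟩
    rwa [projectedField, ← hHeq (mem_closedBall_zero_iff.2 (hbd t hmem))] at hder
  -- At a first time `τ` with `‖γ τ‖ ≥ R`, the path has solved the true equation on `[0, τ]`, so the
  -- a priori bound applies and contradicts the choice of `R`.
  have hbound : ∀ t ∈ Icc 0 b, ‖γ t‖ < R := by
    by_contra! hex
    set S := Icc 0 b ∩ {t | R ≤ ‖γ t‖} with hS
    have hSc : IsClosed S := isClosed_Icc.inter (isClosed_le continuous_const hγc.norm)
    have hSb : BddBelow S := ⟨0, fun t ht => ht.1.1⟩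
    have hτ : sInf S ∈ S := hSc.csInf_mem hex hSb
    set τ := sInf S
    have hsol := hsolves τ hτ.1.1 hτ.1.2 fun t ht => by
      by_contra! hlt
      exact absurd (csInf_le hSb ⟨⟨ht.1.le, ht.2.le.trans hτ.1.2⟩, hlt.le⟩) (not_le.2 ht.2)
    have hV := V_le_of_solvesOn hf (hg.differentiable one_ne_zero) hfconc hgconv hτ.1.1 hsol
      (h0 ▸ hz₀)
    rw [h0, ← hC] at hV
    have hV' : C * τ * Real.exp τ ≤ C * b * Real.exp b := by
      have := hτ.1.1
      have := hτ.1.2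
      gcongr
    have h1 := norm_sub_sq_le_V z₀ (γ τ)
    have h2 : ‖γ τ‖ ≤ ‖z₀‖ + ‖γ τ - z₀‖ := by
      simpa using norm_add_le z₀ (γ τ - z₀)
    have h3 : R ≤ ‖γ τ‖ := hτ.2
    nlinarith [sq_nonneg (‖γ τ - z₀‖ - 1 / 2)]
  exact ⟨γ, h0, hγD, hsolves b hb le_rfl fun t ht => (hbound t ⟨ht.1.le, ht.2.le⟩).le⟩

theorem eq_of_solvesOn (hf : Differentiable ℝ f) (hg : Differentiable ℝ g)
    (hfconc : ConcaveOn ℝ univ f) (hgconv : ∀ i, ConvexOn ℝ univ (fun x => g x i))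
    {γ η : ℝ → State n m} {b : ℝ} (hb : 0 ≤ b) (hγ : SolvesOn (domain n m) (field f g) b γ)
    (hη : SolvesOn (domain n m) (field f g) b η) (h0 : γ 0 = η 0) : γ b = η b := by
  refine eq_of_V_nonpos ((V_antitone_of_solvesOn hf hg hfconc hgconv hb hγ hη).trans ?_)
  rw [h0, V_self]

theorem exists_isCaratheodorySolution (hf : Differentiable ℝ f) (hg : ContDiff ℝ 1 g)
    (hfconc : ConcaveOn ℝ univ f) (hgconv : ∀ i, ConvexOn ℝ univ (fun x => g x i))
    (hfLip : LocallyLipschitz (fun x => gradient f x))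
    (hgLip : ∀ i, LocallyLipschitz (fun x => gradient (fun y => g y i) x))
    {z₀ : State n m} (hz₀ : z₀ ∈ domain n m) :
    ∃ γ : ℝ → State n m, IsCaratheodorySolution (domain n m) (field f g) ⊤ γ ∧ γ 0 = z₀ ∧
      ∀ t, 0 ≤ t → γ t ∈ domain n m := by
  have hgd := hg.differentiable one_ne_zero
  -- The length `N + 1` puts every `t > 0` in the open interval `(0, ⌊t⌋₊ + 1)`, so the glued path
  -- agrees with one solution near `t` and inherits its derivative.
  choose γ h0 hD hγ using fun N : ℕ =>
    exists_solvesOn_field hf hg hfconc hgconv hfLip hgLip (b := N + 1) (by positivity) hz₀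
  have hglue : ∀ (N : ℕ) (t : ℝ), 0 ≤ t → t ≤ N + 1 → γ ⌊t⌋₊ t = γ N t := fun N t ht htN =>
    eq_of_solvesOn hf hgd hfconc hgconv ht ((hγ _).mono ht (Nat.lt_floor_add_one t).le)
      ((hγ N).mono ht htN) ((h0 _).trans (h0 N).symm)
  refine ⟨fun t => γ ⌊t⌋₊ t, ⟨fun b hb _ => ?_, ?_⟩, by simp [h0], fun t ht => hD _ t ht⟩
  · have hb' := (Nat.lt_floor_add_one b).le
    refine ((hγ ⌊b⌋₊).mono hb hb').1.congr fun t ht => ?_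
    rw [uIcc_of_le hb] at ht
    exact (hglue _ t ht.1 (ht.2.trans hb')).symm
  · filter_upwards [ae_all_iff.2 fun N => (hγ N).2, compl_mem_ae_iff.2 (measure_singleton (0 : ℝ))]
      with t ht hne h0t _
    have hpos : 0 < t := lt_of_le_of_ne h0t (Ne.symm hne)
    have hlt := Nat.lt_floor_add_one t
    obtain ⟨h1, h2⟩ := ht ⌊t⌋₊ ⟨hpos, hlt⟩
    refine ⟨h1, h2.congr_of_eventuallyEq ?_⟩
    filter_upwards [Ioo_mem_nhds hpos hlt] with s hs
    exact hglue _ s hs.1.le hs.2.le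

end

end PrimalDual

/-! ### Assembly of the theorem. -/

theorem mainTheorem2 {n m : ℕ}
    (f : EuclideanSpace ℝ (Fin n) → ℝ)
    (g : EuclideanSpace ℝ (Fin n) → EuclideanSpace ℝ (Fin m))
    (hf : ContDiff ℝ 1 f) (hg : ContDiff ℝ 1 g)
    (hfconc : StrictConcaveOn ℝ Set.univ f)
    (hgconv : ∀ i, ConvexOn ℝ Set.univ (fun x => g x i))
    (hfLip : LocallyLipschitz (fun x => gradient f x))
    (hgLip : ∀ i, LocallyLipschitz (fun x => gradient (fun y => g y i) x))
    (hSlater : ∃ x, ∀ i, g x i < 0) :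
    -- existence on `[0, ∞)`, uniqueness, and invariance of the sublevel sets
    (∀ z₀ ∈ PrimalDual.domain n m,
      ∃ γ : ℝ → PrimalDual.State n m,
        PrimalDual.IsCaratheodorySolution (PrimalDual.domain n m) (PrimalDual.field f g) ⊤ γ ∧
        γ 0 = z₀ ∧
        (∀ (T : EReal) (η : ℝ → PrimalDual.State n m),
          PrimalDual.IsCaratheodorySolution (PrimalDual.domain n m) (PrimalDual.field f g) T η →
          η 0 = z₀ → ∀ t : ℝ, 0 ≤ t → (t : EReal) < T → η t = γ t) ∧
        (∀ t : ℝ, 0 ≤ t → γ t ∈ PrimalDual.domain n m) ∧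
        (∀ zs, PrimalDual.IsSaddle f g zs → ∀ t : ℝ, 0 ≤ t →
          PrimalDual.V zs (γ t) ≤ PrimalDual.V zs z₀)) ∧
    -- continuity with respect to the initial condition
    (∀ (z₀ : PrimalDual.State n m) (z : ℕ → PrimalDual.State n m),
      z₀ ∈ PrimalDual.domain n m → (∀ k, z k ∈ PrimalDual.domain n m) →
      Filter.Tendsto z Filter.atTop (nhds z₀) →
      ∀ (γ : ℝ → PrimalDual.State n m) (γs : ℕ → ℝ → PrimalDual.State n m),
        PrimalDual.IsCaratheodorySolution (PrimalDual.domain n m) (PrimalDual.field f g) ⊤ γ →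
        γ 0 = z₀ →
        (∀ k, PrimalDual.IsCaratheodorySolution (PrimalDual.domain n m)
          (PrimalDual.field f g) ⊤ (γs k)) →
        (∀ k, γs k 0 = z k) →
        ∀ K : Set ℝ, IsCompact K → K ⊆ Set.Ici 0 →
          TendstoUniformlyOn γs γ Filter.atTop K) := by
  have hfd := hf.differentiable one_ne_zero
  have hgd := hg.differentiable one_ne_zero
  have hdecr : ∀ {γ η : ℝ → PrimalDual.State n m} {b : ℝ}, 0 ≤ b →
      PrimalDual.SolvesOn (PrimalDual.domain n m) (PrimalDual.field f g) b γ →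
      PrimalDual.SolvesOn (PrimalDual.domain n m) (PrimalDual.field f g) b η →
      PrimalDual.V (η b) (γ b) ≤ PrimalDual.V (η 0) (γ 0) := fun hb h1 h2 =>
    PrimalDual.V_antitone_of_solvesOn hfd hgd hfconc.concaveOn hgconv hb h1 h2
  refine ⟨fun z₀ hz₀ => ?_, ?_⟩
  · obtain ⟨γ, hγ, h0, hD⟩ := PrimalDual.exists_isCaratheodorySolution hfd hg hfconc.concaveOn
      hgconv hfLip hgLip hz₀
    refine ⟨γ, hγ, h0, fun T η hη hη0 t ht htT => ?_, hD, fun zs hzs t ht => ?_⟩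
    · exact PrimalDual.eq_of_solvesOn hfd hgd hfconc.concaveOn hgconv ht (hη.solvesOn ht htT)
        (hγ.solvesOn ht (EReal.coe_lt_top t)) (hη0.trans h0.symm)
    -- A saddle point is compared with `γ` as a constant solution.
    · have h := hdecr ht (hγ.solvesOn ht (EReal.coe_lt_top t)) (η := fun _ => zs)
        ⟨(LipschitzWith.const zs).lipschitzOnWith.absolutelyContinuousOnInterval,
          Filter.Eventually.of_forall fun s _ => ⟨hzs.1, by
            rw [PrimalDual.field_eq_zero_of_isSaddle hfd hgd hzs]
            exact hasDerivAt_const s zs⟩⟩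
      rwa [h0] at h
  · intro z₀ z _ _ hz γ γs hγ h0 hγs hs0 K _ hK
    rw [Metric.tendstoUniformlyOn_iff]
    intro ε hε
    -- Passing from the norm to `V` and back costs a factor 2 in the squares, and `2 * (ε / 2) ^ 2 <
    -- ε ^ 2`. The estimate is uniform over all `t ≥ 0`.
    filter_upwards [Metric.tendsto_nhds.1 hz (ε / 2) (by positivity)] with k hk t ht
    have ht0 : 0 ≤ t := hK ht
    have h1 := hdecr ht0 ((hγs k).solvesOn ht0 (EReal.coe_lt_top t))
      (hγ.solvesOn ht0 (EReal.coe_lt_top t))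
    rw [h0, hs0] at h1
    have h2 := PrimalDual.norm_sub_sq_le_V (γ t) (γs k t)
    have h3 := PrimalDual.V_le_dist_sq z₀ (z k)
    rw [dist_comm, dist_eq_norm]
    refine lt_of_pow_lt_pow_left₀ 2 hε.le ?_
    have h4 : dist (z k) z₀ ^ 2 < (ε / 2) ^ 2 := by gcongr
    nlinarith
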